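/- For a positive integer $n$ let $\mathbb Z_n=\mathbb Z/n\mathbb Z$ and let $S(n)^*=\{x^2 : x\in\mathbb Z_n\}\setminus\{0\}$ be the set of non-zero squares in $\mathbb Z_n$. Let $C_{S(n)^*}$ denote the least positive integer $k$ such that for every sequence $(x_1,\ldots,x_k)$ in $\mathbb Z_n$ there are indices $1\le i\le j\le k$ and weights $a_i,a_{i+1},\ldots,a_j\in S(n)^*$ with $a_ix_i+a_{i+1}x_{i+1}+\cdots+a_jx_j=0$. Theorem. Let $n>1$ be an odd square. Then $C_{S(n)^*}$ exists and $C_{S(n)^*}\le 9$. -/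

import Mathlib

/-- The terms of the sequence `x = (x₁, …, x_k)` in the `R`-module `M` whose indices lie in `I` form
an `A`-weighted zero-sum subsequence: `I` is non-empty and `∑_{i ∈ I} a_i x_i = 0` for some
weights `a_i ∈ A`. -/
def IsWeightedZeroSum {R M : Type*} [Ring R] [AddCommGroup M] [Module R M] (A : Set R)
    {k : ℕ} (x : Fin k → M) (I : Finset (Fin k)) : Prop :=
  I.Nonempty ∧ ∃ a : Fin k → R, (∀ i ∈ I, a i ∈ A) ∧ ∑ i ∈ I, a i • x i = 0

/-- The set of positive integers `k` such that every sequence of length `k` in `M` has an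
`A`-weighted zero-sum subsequence of consecutive terms. -/
def consecutiveZeroSumLengths {R : Type*} [Ring R] (A : Set R) (M : Type*) [AddCommGroup M]
    [Module R M] : Set ℕ :=
  {k | 0 < k ∧ ∀ x : Fin k → M, ∃ i j : Fin k, IsWeightedZeroSum A x (Finset.Icc i j)}

/-- The constant `C_A(M)`: the least positive integer `k` such that every sequence of length `k` in
`M` has an `A`-weighted zero-sum subsequence of consecutive terms
(with the value `0` if there is no such `k`). -/
noncomputable def constC {R : Type*} [Ring R] (A : Set R) (M : Type*) [AddCommGroup M]
    [Module R M] : ℕ :=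
  sInf (consecutiveZeroSumLengths A M)

/-- `S(n)^*`: the set of non-zero squares in `ℤ/nℤ`. -/
def nonzeroSquares (n : ℕ) : Set (ZMod n) :=
  {a | ∃ x : ZMod n, a = x ^ 2} \ {0}

/-! Write `n = (p * q) ^ 2` with `p` an odd prime. Weights `(q * v) ^ 2` with `p ∤ v` are non-zero
modulo `n`, so it suffices to work modulo `p ^ 2` with weights `v ^ 2`. Cut the nine terms into
three blocks of three. If `p` divides a whole block, divide it by `p` and use the three-term result
modulo `p`. Otherwise each block has a term prime to `p`; between three successive such terms
everything vanishes modulo `p`, so the same result gives a zero sum modulo `p`, which lifts to `p ^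
2` in Hensel's manner. -/

/-- Three non-zero elements of `ℤ/pℤ`, `p` an odd prime, have two adjacent terms, or all three, with
a zero sum weighted by non-zero squares. -/
theorem exists_sq_weighted_zero_sum_of_ne_zero {p : ℕ} [Fact p.Prime] {x y z : ZMod p}
    (hx : x ≠ 0) (hy : y ≠ 0) (hz : z ≠ 0) :
    (∃ a b : ZMod p, a ≠ 0 ∧ b ≠ 0 ∧ a ^ 2 * x + b ^ 2 * y = 0) ∨
    (∃ b c : ZMod p, b ≠ 0 ∧ c ≠ 0 ∧ b ^ 2 * y + c ^ 2 * z = 0) ∨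
    (∃ a b c : ZMod p, a ≠ 0 ∧ b ≠ 0 ∧ c ≠ 0 ∧ a ^ 2 * x + b ^ 2 * y + c ^ 2 * z = 0) := by
  by_cases h₁ : IsSquare (-(x * y))
  · obtain ⟨r, hr⟩ := h₁
    refine Or.inl ⟨y, r, hy, ?_, by linear_combination -y * hr⟩
    rintro rfl
    exact mul_ne_zero hx hy (by linear_combination -hr)
  by_cases h₂ : IsSquare (-(y * z))
  · obtain ⟨r, hr⟩ := h₂
    refine Or.inr (Or.inl ⟨r, y, ?_, hy, by linear_combination -y * hr⟩)
    rintro rfl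
    exact mul_ne_zero hy hz (by linear_combination -hr)
  have hxy : -(x * y) ≠ 0 := neg_ne_zero.mpr (mul_ne_zero hx hy)
  have hyz : -(y * z) ≠ 0 := neg_ne_zero.mpr (mul_ne_zero hy hz)
  obtain ⟨r, hr⟩ : IsSquare (-(x * y) * -(y * z)) := by
    have hF : quadraticChar (ZMod p) (-(x * y)) = -1 :=
      quadraticChar_neg_one_iff_not_isSquare.mpr h₁
    have hG : quadraticChar (ZMod p) (-(y * z)) = -1 :=
      quadraticChar_neg_one_iff_not_isSquare.mpr h₂
    refine (quadraticChar_one_iff_isSquare (mul_ne_zero hxy hyz)).mp ?_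
    rw [map_mul, hF, hG]
    norm_num
  have hr0 : r ≠ 0 := by
    rintro rfl
    exact mul_ne_zero hxy hyz (by simpa using hr)
  -- As `-(x * y)` is not a square, neither summand can vanish.
  obtain ⟨a, c, hac⟩ := ZMod.sq_add_sq p (-(x * y))
  have ha : a ≠ 0 := by
    rintro rfl
    exact h₁ ⟨c, by rw [← hac]; ring⟩
  have hc : c ≠ 0 := by
    rintro rfl
    exact h₁ ⟨a, by rw [← hac]; ring⟩
  -- Since `r ^ 2 = x * y ^ 2 * z`, the sum is `x * y ^ 2 * z ^ 2 * (a ^ 2 + c ^ 2 + x * y)`.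
  refine Or.inr (Or.inr ⟨a * (y * z), x * y * z, c * r, mul_ne_zero ha (mul_ne_zero hy hz),
    mul_ne_zero (mul_ne_zero hx hy) hz, mul_ne_zero hc hr0, ?_⟩)
  linear_combination x * y ^ 2 * z ^ 2 * hac - c ^ 2 * z * hr

/-- If `y` vanishes strictly between `i` and `j` and strictly between `j` and `k`, then some interval
with endpoints among `i`, `j`, `k` carries a zero sum weighted by non-zero squares. -/
theorem exists_Icc_sq_weighted_zero_sum {ι : Type*} [LinearOrder ι] [LocallyFiniteOrder ι]
    {p : ℕ} [Fact p.Prime] (y : ι → ZMod p) {i j k : ι} (hij : i < j) (hjk : j < k)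
    (h : ∀ l, i < l → l < k → l ≠ j → y l = 0) :
    ∃ s t : ι, (s = i ∨ s = j ∨ s = k) ∧ s ≤ t ∧ t ≤ k ∧
      ∃ w : ι → ZMod p, (∀ l, w l ≠ 0) ∧ ∑ l ∈ Finset.Icc s t, w l ^ 2 * y l = 0 := by
  by_cases hi : y i = 0
  · exact ⟨i, i, by simp, le_rfl, (hij.trans hjk).le, 1, by simp, by simp [hi]⟩
  by_cases hj : y j = 0
  · exact ⟨j, j, by simp, le_rfl, hjk.le, 1, by simp, by simp [hj]⟩
  by_cases hk : y k = 0
  · exact ⟨k, k, by simp, le_rfl, le_rfl, 1, by simp, by simp [hk]⟩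
  have hik := hij.trans hjk
  have reduce : ∀ (w : ι → ZMod p) (s t : ι) (T : Finset ι), T ⊆ Finset.Icc s t →
      (∀ l, s ≤ l → l ≤ t → l ∉ T → i < l ∧ l < k ∧ l ≠ j) →
      ∑ l ∈ T, w l ^ 2 * y l = 0 → ∑ l ∈ Finset.Icc s t, w l ^ 2 * y l = 0 := by
    intro w s t T hT hl hs
    rw [← Finset.sum_subset hT, hs]
    intro l hl₁ hl₂
    rw [Finset.mem_Icc] at hl₁
    obtain ⟨h₁, h₂, h₃⟩ := hl l hl₁.1 hl₁.2 hl₂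
    rw [h l h₁ h₂ h₃, mul_zero]
  rcases exists_sq_weighted_zero_sum_of_ne_zero hi hj hk with
    ⟨a, b, ha, hb, e⟩ | ⟨b, c, hb, hc, e⟩ | ⟨a, b, c, ha, hb, hc, e⟩
  · refine ⟨i, j, by simp, hij.le, hjk.le, fun l => if l = i then a else b, ?_, ?_⟩
    · intro l; dsimp only; split_ifs <;> assumption
    · refine reduce _ _ _ {i, j} ?_ ?_ ?_
      · simp [Finset.insert_subset_iff, hij.le]
      · intro l h₁ h₂ h₃
        simp only [Finset.mem_insert, Finset.mem_singleton, not_or] at h₃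
        exact ⟨lt_of_le_of_ne h₁ (Ne.symm h₃.1), h₂.trans_lt hjk, h₃.2⟩
      · simp [Finset.sum_pair hij.ne, hij.ne', e]
  · refine ⟨j, k, by simp, hjk.le, le_rfl, fun l => if l = j then b else c, ?_, ?_⟩
    · intro l; dsimp only; split_ifs <;> assumption
    · refine reduce _ _ _ {j, k} ?_ ?_ ?_
      · simp [Finset.insert_subset_iff, hjk.le]
      · intro l h₁ h₂ h₃
        simp only [Finset.mem_insert, Finset.mem_singleton, not_or] at h₃
        exact ⟨hij.trans_le h₁, lt_of_le_of_ne h₂ h₃.2, h₃.1⟩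
      · simp [Finset.sum_pair hjk.ne, hjk.ne', e]
  · refine ⟨i, k, by simp, hik.le, le_rfl,
      fun l => if l = i then a else if l = j then b else c, ?_, ?_⟩
    · intro l; dsimp only; split_ifs <;> assumption
    · refine reduce _ _ _ {i, j, k} ?_ ?_ ?_
      · simp [Finset.insert_subset_iff, hij.le, hjk.le, hik.le]
      · intro l h₁ h₂ h₃
        simp only [Finset.mem_insert, Finset.mem_singleton, not_or] at h₃
        exact ⟨lt_of_le_of_ne h₁ (Ne.symm h₃.1), lt_of_le_of_ne h₂ h₃.2.2, h₃.2.1⟩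
      · rw [Finset.sum_insert (by simp [hij.ne, hik.ne]), Finset.sum_pair hjk.ne]
        simp [hij.ne', hjk.ne', hik.ne', ← e, add_assoc]

/-- Integer form of `exists_Icc_sq_weighted_zero_sum`. -/
theorem exists_Icc_dvd_sum_sq_mul {ι : Type*} [LinearOrder ι] [LocallyFiniteOrder ι]
    {p : ℕ} [Fact p.Prime] (y : ι → ℤ) {i j k : ι} (hij : i < j) (hjk : j < k)
    (h : ∀ l, i < l → l < k → l ≠ j → (p : ℤ) ∣ y l) :
    ∃ s t : ι, (s = i ∨ s = j ∨ s = k) ∧ s ≤ t ∧ t ≤ k ∧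
      ∃ u : ι → ℤ, (∀ l, ¬ (p : ℤ) ∣ u l) ∧
        (p : ℤ) ∣ ∑ l ∈ Finset.Icc s t, u l ^ 2 * y l := by
  obtain ⟨s, t, hs, hst, ht, w, hw, hsum⟩ :=
    exists_Icc_sq_weighted_zero_sum (p := p) (fun l => (y l : ZMod p)) hij hjk
      (fun l h₁ h₂ h₃ => (ZMod.intCast_zmod_eq_zero_iff_dvd _ _).mpr (h l h₁ h₂ h₃))
  refine ⟨s, t, hs, hst, ht, fun l => ((w l).val : ℤ), fun l hl => hw l ?_, ?_⟩
  · simpa using (ZMod.intCast_zmod_eq_zero_iff_dvd _ _).mpr hl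
  · rw [← ZMod.intCast_zmod_eq_zero_iff_dvd]
    simpa using hsum

/-- A zero sum modulo `p` weighted by squares of units lifts to one modulo `p ^ 2` if one of its
terms is a unit. -/
theorem exists_sq_dvd_sum_sq_mul {ι : Type*} {p : ℕ} (hp : p.Prime) (hp2 : p ≠ 2)
    (x u : ι → ℤ) (K : Finset ι) (hu : ∀ l, ¬ (p : ℤ) ∣ u l)
    (hsum : (p : ℤ) ∣ ∑ l ∈ K, u l ^ 2 * x l) {s : ι} (hs : s ∈ K) (hxs : ¬ (p : ℤ) ∣ x s) :
    ∃ v : ι → ℤ, (∀ l, ¬ (p : ℤ) ∣ v l) ∧ (p : ℤ) ^ 2 ∣ ∑ l ∈ K, v l ^ 2 * x l := by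
  classical
  have hpZ : Prime (p : ℤ) := Nat.prime_iff_prime_int.mp hp
  obtain ⟨c, hc⟩ := hsum
  have h2 : ¬ (p : ℤ) ∣ 2 := fun h =>
    hp2 ((Nat.prime_dvd_prime_iff_eq hp Nat.prime_two).mp (by exact_mod_cast h))
  have hcop : IsCoprime (p : ℤ) (2 * u s * x s) := by
    rw [hpZ.coprime_iff_not_dvd]
    intro h
    rcases hpZ.dvd_or_dvd h with h | h
    · exact (hpZ.dvd_or_dvd h).elim h2 (hu s)
    · exact hxs h
  obtain ⟨a, b, hab⟩ := hcop
  -- Here `b` inverts `2 * u s * x s` modulo `p`, so this shift changes the sum `p * c` by `-p * c`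
  -- modulo `p ^ 2`.
  refine ⟨Function.update u s (u s - p * (b * c)), ?_, ?_⟩
  · intro l hl
    by_cases hls : l = s
    · subst hls
      rw [Function.update_self, dvd_sub_left (dvd_mul_right _ _)] at hl
      exact hu l hl
    · rw [Function.update_of_ne hls] at hl
      exact hu l hl
  · rw [← Finset.add_sum_erase K _ hs] at hc ⊢
    have hrest : ∑ l ∈ K.erase s, Function.update u s (u s - p * (b * c)) l ^ 2 * x l =
        ∑ l ∈ K.erase s, u l ^ 2 * x l :=
      Finset.sum_congr rfl fun l hl => by rw [Function.update_of_ne (Finset.ne_of_mem_erase hl)]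
    rw [hrest, Function.update_self]
    exact ⟨a * c + (b * c) ^ 2 * x s, by linear_combination hc - p * c * hab⟩

/-- Three elements of a finite set of a linear order can be chosen adjacent in that set. -/
theorem exists_adjacent_triple {ι : Type*} [LinearOrder ι] (U : Finset ι) {a b c : ι}
    (ha : a ∈ U) (hb : b ∈ U) (hc : c ∈ U) (hab : a < b) (hbc : b < c) :
    ∃ i ∈ U, ∃ j ∈ U, ∃ k ∈ U, i < j ∧ j < k ∧ ∀ l, i < l → l < k → l ≠ j → l ∉ U := by
  -- Keep `c` as the last element and take predecessors in `U` twice.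
  obtain ⟨j, hj, hjmax⟩ := (U.filter (· < c)).exists_max_image id ⟨b, by simp [hb, hbc]⟩
  simp only [Finset.mem_filter, id] at hj hjmax
  obtain ⟨i, hi, himax⟩ := (U.filter (· < j)).exists_max_image id
    ⟨a, by simp [ha, hab.trans_le (hjmax b ⟨hb, hbc⟩)]⟩
  simp only [Finset.mem_filter, id] at hi himax
  refine ⟨i, hi.1, j, hj.1, c, hc, hi.2, hj.2, fun l h₁ h₂ h₃ hl => ?_⟩
  rcases lt_or_gt_of_ne h₃ with h | h
  · exact absurd (himax l ⟨hl, h⟩) (not_le.mpr h₁)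
  · exact absurd (hjmax l ⟨hl, h₂⟩) (not_le.mpr h)

/-- Every sequence of nine integers has consecutive terms whose sum, weighted by squares of units,
is divisible by `p ^ 2`. -/
theorem exists_Icc_sq_dvd_sum_sq_mul {p : ℕ} (hp : p.Prime) (hp2 : p ≠ 2) (x : Fin 9 → ℤ) :
    ∃ s t : Fin 9, s ≤ t ∧ ∃ v : Fin 9 → ℤ, (∀ l, ¬ (p : ℤ) ∣ v l) ∧
      (p : ℤ) ^ 2 ∣ ∑ l ∈ Finset.Icc s t, v l ^ 2 * x l := by
  have := Fact.mk hp
  have block : ∀ i j k : Fin 9, i < j → j < k → (∀ l, i < l → l < k → l = j) →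
      (∀ l, i ≤ l → l ≤ k → (p : ℤ) ∣ x l) →
      ∃ s t : Fin 9, s ≤ t ∧ ∃ v : Fin 9 → ℤ, (∀ l, ¬ (p : ℤ) ∣ v l) ∧
        (p : ℤ) ^ 2 ∣ ∑ l ∈ Finset.Icc s t, v l ^ 2 * x l := by
    intro i j k hij hjk hl hd
    obtain ⟨s, t, hs, hst, ht, u, hu, hsum⟩ :=
      exists_Icc_dvd_sum_sq_mul (p := p) (fun l => x l / p) hij hjk
        (fun l h₁ h₂ h₃ => absurd (hl l h₁ h₂) h₃)
    -- The interval must stay inside the block, where division by `p` is exact.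
    have his : i ≤ s := by
      rcases hs with rfl | rfl | rfl
      exacts [le_rfl, hij.le, (hij.trans hjk).le]
    refine ⟨s, t, hst, u, hu, ?_⟩
    have e : ∑ l ∈ Finset.Icc s t, u l ^ 2 * x l =
        p * ∑ l ∈ Finset.Icc s t, u l ^ 2 * (x l / p) := by
      rw [Finset.mul_sum]
      refine Finset.sum_congr rfl fun l hl => ?_
      rw [Finset.mem_Icc] at hl
      have := Int.mul_ediv_cancel' (hd l (his.trans hl.1) (hl.2.trans ht))
      linear_combination -(u l ^ 2) * this
    rw [e, pow_two]
    exact mul_dvd_mul_left _ hsum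
  by_cases h₀ : ∀ l : Fin 9, 0 ≤ l → l ≤ 2 → (p : ℤ) ∣ x l
  · exact block 0 1 2 (by decide) (by decide) (by decide) h₀
  by_cases h₁ : ∀ l : Fin 9, 3 ≤ l → l ≤ 5 → (p : ℤ) ∣ x l
  · exact block 3 4 5 (by decide) (by decide) (by decide) h₁
  by_cases h₂ : ∀ l : Fin 9, 6 ≤ l → l ≤ 8 → (p : ℤ) ∣ x l
  · exact block 6 7 8 (by decide) (by decide) (by decide) h₂
  push Not at h₀ h₁ h₂
  obtain ⟨a, -, ha, hxa⟩ := h₀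
  obtain ⟨b, hb, hb', hxb⟩ := h₁
  obtain ⟨c, hc, -, hxc⟩ := h₂
  obtain ⟨i, hi, j, hj, k, hk, hij, hjk, hl⟩ :=
    exists_adjacent_triple (Finset.univ.filter fun l => ¬ (p : ℤ) ∣ x l)
      (a := a) (b := b) (c := c) (by simpa) (by simpa) (by simpa)
      (ha.trans_lt (lt_of_lt_of_le (by decide) hb)) (hb'.trans_lt (lt_of_lt_of_le (by decide) hc))
  simp only [Finset.mem_filter, Finset.mem_univ, true_and, not_not] at hi hj hk hl
  obtain ⟨s, t, hs, hst, -, u, hu, hsum⟩ := exists_Icc_dvd_sum_sq_mul x hij hjk hl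
  -- The left endpoint is the unit term that the lifting needs.
  have hxs : ¬ (p : ℤ) ∣ x s := by
    rcases hs with rfl | rfl | rfl <;> assumption
  exact ⟨s, t, hst, exists_sq_dvd_sum_sq_mul hp hp2 x u _ hu hsum
    (Finset.left_mem_Icc.mpr hst) hxs⟩

/-- Multiplying a zero sum modulo `p ^ 2` by `q ^ 2` makes it one modulo `n`. -/
theorem nine_mem_consecutiveZeroSumLengths {n : ℕ} (hn : 1 < n) (hodd : Odd n)
    (hsq : IsSquare n) : 9 ∈ consecutiveZeroSumLengths (nonzeroSquares n) (ZMod n) := by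
  refine ⟨by norm_num, fun x => ?_⟩
  obtain ⟨m, rfl⟩ := hsq
  have hm : m ≠ 1 := by rintro rfl; simp at hn
  obtain ⟨p, hp, q, rfl⟩ := Nat.exists_prime_and_dvd hm
  have hp2 : p ≠ 2 := by
    rintro rfl
    rw [← Nat.not_even_iff_odd] at hodd
    exact hodd (by simp)
  have hq : (q : ℤ) ≠ 0 := by
    rintro h
    have : q = 0 := by exact_mod_cast h
    simp [this] at hn
  have hpZ : Prime (p : ℤ) := Nat.prime_iff_prime_int.mp hp
  have : NeZero (p * q * (p * q)) := ⟨by omega⟩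
  obtain ⟨s, t, hst, v, hv, hsum⟩ :=
    exists_Icc_sq_dvd_sum_sq_mul hp hp2 (fun l => ((x l).val : ℤ))
  have hcast : ((p * q * (p * q) : ℕ) : ℤ) = (q : ℤ) ^ 2 * (p : ℤ) ^ 2 := by push_cast; ring
  refine ⟨s, t, Finset.nonempty_Icc.mpr hst,
    fun l => (((q * v l : ℤ)) : ZMod (p * q * (p * q))) ^ 2, fun l _ => ⟨⟨_, rfl⟩, ?_⟩, ?_⟩
  · intro h
    have h' : (((q * v l) ^ 2 : ℤ) : ZMod (p * q * (p * q))) = 0 := by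
      rw [Int.cast_pow]; exact h
    rw [ZMod.intCast_zmod_eq_zero_iff_dvd, hcast, mul_pow,
      mul_dvd_mul_iff_left (pow_ne_zero 2 hq)] at h'
    exact hv l (hpZ.dvd_of_dvd_pow ((dvd_pow_self _ two_ne_zero).trans h'))
  · have h := mul_dvd_mul_left ((q : ℤ) ^ 2) hsum
    rw [← hcast, ← ZMod.intCast_zmod_eq_zero_iff_dvd, Finset.mul_sum, Int.cast_sum] at h
    rw [← h]
    refine Finset.sum_congr rfl fun l _ => ?_
    rw [smul_eq_mul]
    push_cast
    rw [ZMod.natCast_zmod_val]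
    ring

/-- For every odd square `n > 1` the constant `C_{S(n)^*}` exists (it really is the least element of
the set that defines it, not a default value) and is at most `9`. -/
theorem mainTheorem3 (n : ℕ) (hn : 1 < n) (hodd : Odd n) (hsq : IsSquare n) :
    IsLeast (consecutiveZeroSumLengths (nonzeroSquares n) (ZMod n))
        (constC (nonzeroSquares n) (ZMod n)) ∧
      constC (nonzeroSquares n) (ZMod n) ≤ 9 := by
  have h := nine_mem_consecutiveZeroSumLengths hn hodd hsq
  exact ⟨⟨Nat.sInf_mem ⟨9, h⟩, fun _ hk => Nat.sInf_le hk⟩, Nat.sInf_le h⟩
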